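/- Conventions. A \emph{semitopological semigroup} is a semigroup $S$ with a Hausdorff topology such that for each $t\in S$ the maps $s\mapsto ts$ and $s\mapsto st$ are continuous on $S$. A \emph{left ideal} of $S$ is a nonempty subset $I\subseteq S$ with $SI\subseteq I$; $S$ is \emph{right reversible} if any two closed left ideals of $S$ intersect. Let $\operatorname{CB}(S)$ be the Banach space of bounded continuous real-valued functions on $S$ with the supremum norm, let $(l_sf)(t)=f(st)$ for $f\in\operatorname{CB}(S)$ and $s,t\in S$, and let $\operatorname{LUC}(S)$ be the space of those $f\in\operatorname{CB}(S)$ for which $s\mapsto l_sf$ is norm continuous from $S$ into $\operatorname{CB}(S)$. $S$ is \emph{left amenable} if there is a bounded linear functional $m$ on $\operatorname{LUC}(S)$ with $\|m\|=m(1)=1$ and $m(l_sf)=m(f)$ for all $s\in S$, $f\in\operatorname{LUC}(S)$. An \emph{action} of $S$ on a set $K$ is a map $S\times K\to K$, $(s,x)\mapsto s.x$, with $(st).x=s.(t.x)$ for all $s,t\in S$ and $x\in K$. If $K$ is a subset of a dual Banach space, the action is \emph{jointly weak* continuous} if this map is continuous on $S\times K$ when $K$ carries the weak* topology, and \emph{super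 asymptotically nonexpansive} if for all $x\in K$ and $t\in S$ there is a left ideal $I_{x,t}$ of $S$ with $I_{x,t}\subseteq St$ such that $\|s.x-s.y\|\le\|x-y\|$ for all $s\in I_{x,t}$ and all $y\in K$. Theorem. Let $S$ be a right reversible and left amenable semitopological semigroup. Let $E$ be a real or complex Banach space and let $K$ be a nonempty, weak* compact, convex and norm-separable subset of the dual Banach space $E^*$. Then every jointly weak* continuous and super asymptotically nonexpansive action of $S$ on $K$ has a common fixed point, that is, there is $x_0\in K$ with $s.x_0=x_0$ for all $s\in S$. -/

import Mathlib

open scoped BoundedContinuousFunction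

noncomputable section

namespace SemitopologicalSemigroup

/-- A left ideal of a semigroup `S`: a nonempty subset `I` with `S I ⊆ I`. -/
structure IsLeftIdeal {S : Type*} [Semigroup S] (I : Set S) : Prop where
  nonempty : I.Nonempty
  mul_mem : ∀ s : S, ∀ a ∈ I, s * a ∈ I

/-- A subset `I` of `S` is supported by `t` if `I ⊆ S t`. -/
def IsSupportedBy {S : Type*} [Semigroup S] (I : Set S) (t : S) : Prop :=
  I ⊆ Set.range fun s : S => s * t

/-- `S` is right reversible if any two closed left ideals of `S` intersect. -/
def IsRightReversible (S : Type*) [Semigroup S] [TopologicalSpace S] : Prop :=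
  ∀ I J : Set S, IsLeftIdeal I → IsLeftIdeal J → IsClosed I → IsClosed J → (I ∩ J).Nonempty

section LUC

variable {S : Type*} [Semigroup S] [TopologicalSpace S] [SeparatelyContinuousMul S]

/-- The left translation of `f ∈ CB(S)` by `s`: `(l_s f)(t) = f (s t)`. -/
def leftTranslate (s : S) (f : S →ᵇ ℝ) : S →ᵇ ℝ :=
  f.compContinuous ⟨fun t => s * t, continuous_const_mul s⟩

@[simp]
theorem leftTranslate_apply (s : S) (f : S →ᵇ ℝ) (t : S) :
    leftTranslate s f t = f (s * t) := rfl

variable (S) in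
/-- The space `LUC(S)` of left uniformly continuous functions on `S`: those `f ∈ CB(S)` for which
`s ↦ l_s f` is continuous from `S` to `CB(S)` with the supremum norm. (The linear structure is spelled out as the one
underlying the normed space `CB(S)`, so that the operator norm on the dual of `LUC(S)` is found.) -/
def LUC : @Submodule ℝ (S →ᵇ ℝ) _ SeminormedAddCommGroup.toAddCommGroup.toAddCommMonoid
    NormedSpace.toModule where
  carrier := {f | Continuous fun s : S => leftTranslate s f}
  zero_mem' := (continuous_const : Continuous fun _ : S => (0 : S →ᵇ ℝ))
  add_mem' := fun {_ _} hf hg => Continuous.add hf hg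
  smul_mem' := fun c _ hf => Continuous.const_smul hf c

theorem mem_LUC {f : S →ᵇ ℝ} : f ∈ LUC S ↔ Continuous fun s : S => leftTranslate s f := Iff.rfl

theorem one_mem_LUC : (1 : S →ᵇ ℝ) ∈ LUC S :=
  (continuous_const : Continuous fun _ : S => (1 : S →ᵇ ℝ))

theorem leftTranslate_mem_LUC (s : S) {f : S →ᵇ ℝ} (hf : f ∈ LUC S) :
    leftTranslate s f ∈ LUC S := by
  have h : (fun t : S => leftTranslate t (leftTranslate s f))
      = fun t : S => leftTranslate (s * t) f := by
    funext t
    ext x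
    simp [mul_assoc]
  rw [mem_LUC, h]
  exact (mem_LUC.1 hf).comp (continuous_const_mul s)

/-- A mean on `LUC(S)`: a bounded linear functional `m` with `‖m‖ = m(1) = 1`. -/
def IsMean (m : LUC S →L[ℝ] ℝ) : Prop :=
  ‖m‖ = 1 ∧ m ⟨1, one_mem_LUC⟩ = 1

/-- A left invariant mean on `LUC(S)`: a mean `m` with `m(l_s f) = m(f)`. -/
def IsLeftInvariantMean (m : LUC S →L[ℝ] ℝ) : Prop :=
  IsMean m ∧ ∀ (s : S) (f : LUC S), m ⟨leftTranslate s f, leftTranslate_mem_LUC s f.2⟩ = m f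

variable (S) in
/-- `S` is left amenable if `LUC(S)` has a left invariant mean. -/
def IsLeftAmenable : Prop :=
  ∃ m : LUC S →L[ℝ] ℝ, IsLeftInvariantMean m

end LUC

/-- An action of `S` on a subset `K` of the dual of `E` is super asymptotically nonexpansive if for
all `x ∈ K` and `t ∈ S` there is a left ideal `I` of `S` supported by `t` such that
`‖s.x - s.y‖ ≤ ‖x - y‖` (dual norm) for all `s ∈ I` and all `y ∈ K`. -/
def IsSuperAsymptoticallyNonexpansive (S : Type*) [Semigroup S]
    {𝕜 : Type*} [RCLike 𝕜] {E : Type*} [NormedAddCommGroup E] [NormedSpace 𝕜 E]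
    (K : Set (WeakDual 𝕜 E)) [SemigroupAction S K] : Prop :=
  ∀ (x : K) (t : S), ∃ I : Set S, IsLeftIdeal I ∧ IsSupportedBy I t ∧
    ∀ s ∈ I, ∀ y : K,
      ‖WeakDual.toStrongDual (s • x : K).1 - WeakDual.toStrongDual (s • y : K).1‖
        ≤ ‖WeakDual.toStrongDual x.1 - WeakDual.toStrongDual y.1‖

end SemitopologicalSemigroup

end

open Set Topology

namespace SemitopologicalSemigroup

/-! ### Minimal compact sets. -/

section Zorn

/-! Distances need only shrink along ideals, so a normal-structure argument is run with asymptotic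
orbits in place of orbits. Take C minimal among nonempty weak* compact convex subsets of K that
contain `limitSet S x` for each of their points x, and a minimal compact invariant set F inside one
such limit set.

An invariant mean pulled back along an orbit in F has support F, so each s maps F onto F
(`IsMinimalInvariant.exists_smul_eq`). Baire's theorem gives a norm-small relatively weak* open
piece of F; right reversibility yields one s that shrinks every member of a finite cover of F, and
sF = F makes F norm totally bounded (`IsMinimalInvariant.totallyBounded_image`).

If F had two points, some u in its convex hull would lie within r < diam F of all of F
(`exists_mem_convexHull_dist_le_lt_diam`). Intersecting C with the r-balls centred in F keeps its
defining property, again because sF = F. By minimality F lies in all these balls, so diam F ≤ r, a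
contradiction. Hence F is a single fixed point. -/

/-- Zorn's lemma for nonempty compact sets having a property that is stable under intersections
of nonempty chains. -/
theorem exists_minimal_isCompact {Y : Type*} [TopologicalSpace Y] [T2Space Y] {P : Set Y → Prop}
    (hP : ∀ c : Set (Set Y), (∀ A ∈ c, P A) → c.Nonempty → P (⋂₀ c))
    {A : Set Y} (hA : IsCompact A) (hne : A.Nonempty) (hPA : P A) :
    ∃ F ⊆ A, Minimal (fun B => IsCompact B ∧ B.Nonempty ∧ P B) F := by
  refine zorn_superset_nonempty {B | IsCompact B ∧ B.Nonempty ∧ P B} ?_ A ⟨hA, hne, hPA⟩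
  intro c hc hchain hcne
  have : Nonempty c := hcne.to_subtype
  refine ⟨⋂₀ c, ⟨?_, ?_, hP c (fun A hA => (hc hA).2.2) hcne⟩, fun s hs => sInter_subset_of_mem hs⟩
  · obtain ⟨B, hB⟩ := hcne
    exact (hc hB).1.of_isClosed_subset (isClosed_sInter fun A hA => (hc hA).1.isClosed)
      (sInter_subset_of_mem hB)
  · refine IsCompact.nonempty_sInter_of_directed_nonempty_isCompact_isClosed
      ?_ (fun U hU => (hc hU).2.1) (fun U hU => (hc hU).1)
      (fun U hU => (hc hU).1.isClosed)
    intro B hB D hD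
    rcases hchain.total hB hD with h | h
    exacts [⟨B, hB, subset_rfl, h⟩, ⟨D, hD, h, subset_rfl⟩]

end Zorn

/-! ### Closed left ideals. -/

section Ideals

variable {S : Type*} [Semigroup S]

theorem IsLeftIdeal.univ [Nonempty S] : IsLeftIdeal (Set.univ : Set S) :=
  ⟨univ_nonempty, fun _ _ _ => mem_univ _⟩

theorem IsLeftIdeal.image_mul_right {I : Set S} (hI : IsLeftIdeal I) (t : S) :
    IsLeftIdeal ((fun s => s * t) '' I) := by
  refine ⟨hI.nonempty.image _, ?_⟩
  rintro s _ ⟨a, ha, rfl⟩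
  exact ⟨s * a, hI.mul_mem s a ha, mul_assoc s a t⟩

variable [TopologicalSpace S]

theorem IsLeftIdeal.closure [SeparatelyContinuousMul S] {I : Set S} (hI : IsLeftIdeal I) :
    IsLeftIdeal (closure I) :=
  ⟨hI.nonempty.closure, fun s _ ha =>
    map_mem_closure (continuous_const_mul s) ha fun b hb => hI.mul_mem s b hb⟩

theorem IsRightReversible.inter (h : IsRightReversible S) {I J : Set S} (hI : IsLeftIdeal I)
    (hJ : IsLeftIdeal J) (hIc : IsClosed I) (hJc : IsClosed J) : IsLeftIdeal (I ∩ J) :=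
  ⟨h I J hI hJ hIc hJc, fun s a ha => ⟨hI.mul_mem s a ha.1, hJ.mul_mem s a ha.2⟩⟩

/-- In a right reversible semigroup, finitely many closed left ideals intersect. -/
theorem IsRightReversible.biInter_nonempty [Nonempty S] (h : IsRightReversible S) {ι : Type*}
    (t : Finset ι) (I : ι → Set S) (hI : ∀ i, IsLeftIdeal (I i)) (hc : ∀ i, IsClosed (I i)) :
    (⋂ i ∈ t, I i).Nonempty := by
  classical
  suffices h' : IsLeftIdeal (⋂ i ∈ t, I i) from h'.nonempty
  induction t using Finset.induction_on with
  | empty => simpa using IsLeftIdeal.univ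
  | insert a t _ ih =>
    rw [Finset.set_biInter_insert]
    exact h.inter (hI a) ih (hc a) (isClosed_biInter fun i _ => hc i)

end Ideals

/-! ### Minimal invariant sets and asymptotic orbits. -/

section Action

variable {S : Type*} [Semigroup S] {X : Type*} [TopologicalSpace X] [SemigroupAction S X]

/-- A subset of `X` is invariant if it is mapped into itself by all elements of `S`. -/
def IsInvariant (S : Type*) [Semigroup S] {X : Type*} [SemigroupAction S X] (A : Set X) : Prop :=
  ∀ s : S, ∀ x ∈ A, s • x ∈ A

theorem isInvariant_closure_orbit [ContinuousConstSMul S X] {I : Set S} (hI : IsLeftIdeal I)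
    (x : X) : IsInvariant S (closure ((fun s : S => s • x) '' I)) := by
  intro s y hy
  refine map_mem_closure (continuous_const_smul s) hy ?_
  rintro _ ⟨a, ha, rfl⟩
  exact ⟨s * a, hI.mul_mem s a ha, mul_smul s a x⟩

variable (S) in
/-- A minimal nonempty compact invariant set. -/
def IsMinimalInvariant (F : Set X) : Prop :=
  Minimal (fun B : Set X => IsCompact B ∧ B.Nonempty ∧ IsInvariant S B) F

theorem exists_isMinimalInvariant [T2Space X] {A : Set X} (hA : IsCompact A) (hne : A.Nonempty)
    (hinv : IsInvariant S A) : ∃ F ⊆ A, IsMinimalInvariant S F :=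
  exists_minimal_isCompact (P := IsInvariant S)
    (fun _ hc _ s x hx => mem_sInter.2 fun B hB => hc B hB s x (mem_sInter.1 hx B hB)) hA hne hinv

theorem IsMinimalInvariant.eq_of_subset {F A : Set X} (hF : IsMinimalInvariant S F)
    (hA : IsCompact A) (hne : A.Nonempty) (hinv : IsInvariant S A) (hAF : A ⊆ F) : A = F :=
  (Minimal.eq_of_subset hF ⟨hA, hne, hinv⟩ hAF)

/-- By minimality every orbit in `F` is dense in `F`. -/
theorem IsMinimalInvariant.exists_smul_mem [T2Space X] [ContinuousConstSMul S X] [Nonempty S]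
    {F : Set X} (hF : IsMinimalInvariant S F) {V : Set X} (hV : IsOpen V) (hVF : (V ∩ F).Nonempty)
    {x : X} (hx : x ∈ F) : ∃ s : S, s • x ∈ V := by
  have hsub : closure ((fun s : S => s • x) '' Set.univ) ⊆ F := by
    refine closure_minimal ?_ hF.prop.1.isClosed
    rintro _ ⟨s, -, rfl⟩
    exact hF.prop.2.2 s x hx
  have h := hF.eq_of_subset (hF.prop.1.of_isClosed_subset isClosed_closure hsub)
    (univ_nonempty.image _).closure (isInvariant_closure_orbit IsLeftIdeal.univ x) hsub
  obtain ⟨y, hyV, hyF⟩ := hVF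
  rw [← h] at hyF
  obtain ⟨_, hz, s, -, rfl⟩ := mem_closure_iff.1 hyF V hV hyV
  exact ⟨s, hz⟩

variable [TopologicalSpace S]

variable (S) in
/-- The asymptotic orbit of `x`: the intersection of the closures of the orbits of `x` under the
closed left ideals of `S`. -/
def limitSet (x : X) : Set X :=
  ⋂ I : {I : Set S // IsLeftIdeal I ∧ IsClosed I}, closure ((fun s : S => s • x) '' I.1)

theorem limitSet_subset {I : Set S} (hI : IsLeftIdeal I) (hc : IsClosed I) (x : X) :
    limitSet S x ⊆ closure ((fun s : S => s • x) '' I) :=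
  iInter_subset (fun I : {I : Set S // IsLeftIdeal I ∧ IsClosed I} =>
    closure ((fun s : S => s • x) '' I.1)) ⟨I, hI, hc⟩

theorem isClosed_limitSet (x : X) : IsClosed (limitSet S x) :=
  isClosed_iInter fun _ => isClosed_closure

/-- Right reversibility makes the family of orbit closures directed, so compactness applies. -/
theorem limitSet_nonempty [CompactSpace X] [Nonempty S] (h : IsRightReversible S) (x : X) :
    (limitSet S x).Nonempty := by
  have : Nonempty {I : Set S // IsLeftIdeal I ∧ IsClosed I} :=
    ⟨⟨Set.univ, IsLeftIdeal.univ, isClosed_univ⟩⟩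
  refine IsCompact.nonempty_iInter_of_directed_nonempty_isCompact_isClosed _ ?_
    (fun I => (I.2.1.nonempty.image _).closure) (fun I => isClosed_closure.isCompact)
    (fun I => isClosed_closure)
  intro I J
  exact ⟨⟨I.1 ∩ J.1, h.inter I.2.1 J.2.1 I.2.2 J.2.2, I.2.2.inter J.2.2⟩,
    closure_mono (image_mono inter_subset_left), closure_mono (image_mono inter_subset_right)⟩

theorem isInvariant_limitSet [ContinuousConstSMul S X] (x : X) :
    IsInvariant S (limitSet S x) := fun s y hy =>
  mem_iInter.2 fun I => isInvariant_closure_orbit I.2.1 x s y (mem_iInter.1 hy I)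

end Action

/-! ### Positivity of means. -/

section IsMean

variable {S : Type*} [Semigroup S] [TopologicalSpace S] [SeparatelyContinuousMul S]

/-- If 0 ≤ f ≤ c with c = ‖f‖, then ‖c - f‖ ≤ c, so c - m(f) ≤ c. -/
theorem IsMean.nonneg {m : LUC S →L[ℝ] ℝ} (hm : IsMean m) (f : LUC S)
    (hf : ∀ s, 0 ≤ (f : S →ᵇ ℝ) s) : 0 ≤ m f := by
  set c := ‖(f : S →ᵇ ℝ)‖ with hc
  have hle : ‖c • (⟨1, one_mem_LUC⟩ : LUC S) - f‖ ≤ c := by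
    change ‖c • (1 : S →ᵇ ℝ) - (f : S →ᵇ ℝ)‖ ≤ c
    refine (BoundedContinuousFunction.norm_le (norm_nonneg _)).2 fun s => ?_
    have h1 : (f : S →ᵇ ℝ) s ≤ c := (le_abs_self _).trans ((f : S →ᵇ ℝ).norm_coe_le_norm s)
    have h2 : (c • (1 : S →ᵇ ℝ) - (f : S →ᵇ ℝ)) s = c - (f : S →ᵇ ℝ) s := by simp
    rw [h2, Real.norm_eq_abs, abs_le]
    constructor <;> linarith [hf s]
  have h := (le_abs_self _).trans (m.le_opNorm (c • (⟨1, one_mem_LUC⟩ : LUC S) - f))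
  rw [hm.1, one_mul, map_sub, map_smul, hm.2, smul_eq_mul, mul_one] at h
  linarith

theorem IsMean.nonempty {m : LUC S →L[ℝ] ℝ} (hm : IsMean m) : Nonempty S := by
  by_contra hS
  rw [not_nonempty_iff] at hS
  have h : (⟨1, one_mem_LUC⟩ : LUC S) = 0 := Subtype.ext (by ext s; exact hS.elim s)
  have := hm.2
  rw [h, map_zero] at this
  exact zero_ne_one this

end IsMean

/-! ### Invariant means transported to compact spaces, and their supports. -/

section Mean

variable {S : Type*} [Semigroup S] [TopologicalSpace S]

variable {X : Type*} [TopologicalSpace X] [CompactSpace X] [SemigroupAction S X]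
  [ContinuousSMul S X]

/-- The function `s ↦ f (s • p)` on `S`. -/
def orbitFunction (p : X) (f : C(X, ℝ)) : S →ᵇ ℝ :=
  (BoundedContinuousFunction.mkOfCompact f).compContinuous
    ⟨fun s : S => s • p, continuous_id.smul continuous_const⟩

@[simp]
theorem orbitFunction_apply (p : X) (f : C(X, ℝ)) (s : S) :
    orbitFunction p f s = f (s • p) := rfl

theorem lipschitzWith_orbitFunction (p : X) :
    LipschitzWith 1 (orbitFunction p : C(X, ℝ) → S →ᵇ ℝ) :=
  LipschitzWith.of_dist_le_mul fun f g => by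
    rw [NNReal.coe_one, one_mul, BoundedContinuousFunction.dist_le dist_nonneg]
    exact fun s => ContinuousMap.dist_apply_le_dist (s • p)

variable [SeparatelyContinuousMul S]

/-- Joint continuity of the action enters here: currying (s, x) ↦ f(s • x) is continuous into `C(X,
ℝ)` with the uniform norm. -/
theorem orbitFunction_mem_LUC (p : X) (f : C(X, ℝ)) : (orbitFunction p f : S →ᵇ ℝ) ∈ LUC S := by
  let g : C(S × X, ℝ) := ⟨fun q => f (q.1 • q.2), f.continuous.comp continuous_smul⟩
  have h : (fun s : S => leftTranslate s (orbitFunction p f))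
      = fun s : S => (orbitFunction p (g.curry s) : S →ᵇ ℝ) := by
    funext s
    ext t
    simp [g, mul_smul]
  rw [mem_LUC, h]
  exact (lipschitzWith_orbitFunction p).continuous.comp g.curry.continuous

/-- The pullback of a functional on `LUC(S)` to `C(X)` along the orbit of `p`. -/
noncomputable def orbitMean (m : LUC S →L[ℝ] ℝ) (p : X) : C(X, ℝ) →ₗ[ℝ] ℝ where
  toFun f := m ⟨orbitFunction p f, orbitFunction_mem_LUC p f⟩
  map_add' f g := by
    rw [← map_add]
    rfl
  map_smul' c f := by
    rw [RingHom.id_apply, ← map_smul]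
    rfl

theorem orbitMean_comp_smul {m : LUC S →L[ℝ] ℝ} (hm : IsLeftInvariantMean m) (p : X) (s : S)
    (f : C(X, ℝ)) :
    orbitMean m p (f.comp ⟨fun x => s • x, continuous_const_smul s⟩) = orbitMean m p f := by
  refine Eq.trans ?_ (hm.2 s ⟨orbitFunction p f, orbitFunction_mem_LUC p f⟩)
  refine congrArg m (Subtype.ext ?_)
  ext t
  simp [mul_smul]

theorem orbitMean_nonneg {m : LUC S →L[ℝ] ℝ} (hm : IsMean m) (p : X) (f : C(X, ℝ))
    (hf : ∀ s : S, 0 ≤ f (s • p)) : 0 ≤ orbitMean m p f :=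
  hm.nonneg _ hf

theorem orbitMean_mono {m : LUC S →L[ℝ] ℝ} (hm : IsMean m) (p : X) (f g : C(X, ℝ))
    (hf : ∀ s : S, f (s • p) ≤ g (s • p)) : orbitMean m p f ≤ orbitMean m p g := by
  rw [← sub_nonneg, ← map_sub]
  exact orbitMean_nonneg hm p _ fun s => by simpa using hf s

theorem orbitMean_one {m : LUC S →L[ℝ] ℝ} (hm : IsMean m) (p : X) : orbitMean m p 1 = 1 :=
  hm.2

/-- The support of the functional `orbitMean m p`. -/
def orbitMeanSupport (m : LUC S →L[ℝ] ℝ) (p : X) : Set X :=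
  {x | ∀ f : C(X, ℝ), 0 ≤ f → 0 < f x → 0 < orbitMean m p f}

theorem isClosed_orbitMeanSupport (m : LUC S →L[ℝ] ℝ) (p : X) :
    IsClosed (orbitMeanSupport m p) := by
  refine isOpen_compl_iff.1 (isOpen_iff_mem_nhds.2 fun x hx => ?_)
  simp only [orbitMeanSupport, mem_compl_iff, mem_ofPred_eq, not_forall] at hx
  obtain ⟨f, hf, hfx, hmf⟩ := hx
  filter_upwards [f.continuous.continuousAt.eventually (lt_mem_nhds hfx)] with y hy hyS
  exact hmf (hyS f hf hy)

/-- Otherwise finitely many nonnegative functions of nonpositive mean add up to a function bounded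
below by a positive constant, whose mean is positive. -/
theorem orbitMeanSupport_nonempty {m : LUC S →L[ℝ] ℝ} (hm : IsMean m) (p : X) :
    (orbitMeanSupport m p).Nonempty := by
  by_contra hempty
  have h : ∀ x, ∃ f : C(X, ℝ), 0 ≤ f ∧ 0 < f x ∧ orbitMean m p f ≤ 0 := by
    intro x
    by_contra! hx
    exact hempty ⟨x, hx⟩
  choose f hf0 hfx hmf using h
  obtain ⟨t, ht⟩ := isCompact_univ.elim_finite_subcover (fun x => {y | 0 < f x y})
    (fun x => isOpen_lt continuous_const (f x).continuous) fun x _ => mem_iUnion.2 ⟨x, hfx x⟩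
  let g : C(X, ℝ) := ∑ x ∈ t, f x
  have hg : ∀ y, 0 < g y := by
    intro y
    obtain ⟨x, hxt, hxy⟩ := mem_iUnion₂.1 (ht (mem_univ y))
    have : f x y ≤ g y := by
      simp only [g, ContinuousMap.coe_sum, Finset.sum_apply]
      exact Finset.single_le_sum (f := fun x => f x y) (fun z _ => hf0 z y) hxt
    exact lt_of_lt_of_le hxy this
  obtain ⟨z, -, hz⟩ := isCompact_univ.exists_isMinOn ⟨p, mem_univ p⟩ g.continuous.continuousOn
  have h1 : orbitMean m p (g z • (1 : C(X, ℝ))) ≤ orbitMean m p g :=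
    orbitMean_mono hm p _ _ fun s => by simpa using hz (mem_univ (s • p))
  have h2 : orbitMean m p g ≤ 0 := by
    simp only [g, map_sum]
    exact Finset.sum_nonpos fun x _ => hmf x
  rw [map_smul, orbitMean_one hm, smul_eq_mul, mul_one] at h1
  linarith [hg z]

theorem isInvariant_orbitMeanSupport {m : LUC S →L[ℝ] ℝ} (hm : IsLeftInvariantMean m) (p : X) :
    IsInvariant S (orbitMeanSupport m p) := by
  intro s x hx f hf hfx
  rw [← orbitMean_comp_smul hm p s f]
  exact hx _ (fun y => hf (s • y)) hfx

theorem orbitMeanSupport_subset [T2Space X] (m : LUC S →L[ℝ] ℝ) {p : X} {F : Set X}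
    (hF : IsClosed F) (hinv : IsInvariant S F) (hp : p ∈ F) : orbitMeanSupport m p ⊆ F := by
  intro x hx
  by_contra hxF
  obtain ⟨f, hf0, hf1, hf⟩ := exists_continuous_zero_one_of_isClosed hF isClosed_singleton
    (disjoint_singleton_right.2 hxF)
  have h := hx f (fun y => (hf y).1) (by rw [hf1 (mem_singleton x)]; exact one_pos)
  have h0 : (⟨orbitFunction p f, orbitFunction_mem_LUC p f⟩ : LUC S) = 0 :=
    Subtype.ext (by ext s; exact hf0 (hinv s p hp))
  have h1 : orbitMean m p f = 0 := (congrArg m h0).trans (map_zero m)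
  exact h.ne' h1

/-- If `S` is left amenable, then its elements map a minimal invariant set onto itself. -/
theorem IsMinimalInvariant.exists_smul_eq [T2Space X] (hS : IsLeftAmenable S) {F : Set X}
    (hF : IsMinimalInvariant S F) (s : S) {x : X} (hx : x ∈ F) : ∃ y ∈ F, s • y = x := by
  obtain ⟨m, hm⟩ := hS
  obtain ⟨p, hp⟩ := hF.prop.2.1
  have hsupp : orbitMeanSupport m p = F := hF.eq_of_subset
    (isClosed_orbitMeanSupport m p).isCompact (orbitMeanSupport_nonempty hm.1 p)
    (isInvariant_orbitMeanSupport hm p)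
    (orbitMeanSupport_subset m hF.prop.1.isClosed hF.prop.2.2 hp)
  by_contra! hxs
  have hcl : IsClosed ((fun y : X => s • y) '' F) :=
    (hF.prop.1.image (continuous_const_smul s)).isClosed
  have hxs' : x ∉ (fun y : X => s • y) '' F := by
    rintro ⟨y, hy, hyx⟩
    exact hxs y hy hyx
  obtain ⟨f, hf0, hf1, hf⟩ := exists_continuous_zero_one_of_isClosed hcl isClosed_singleton
    (disjoint_singleton_right.2 hxs')
  rw [← hsupp] at hx
  have h := hx f (fun y => (hf y).1) (by rw [hf1 (mem_singleton x)]; exact one_pos)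
  -- `f` vanishes on sF, so `f ∘ s` vanishes along the orbit of `p`; invariance then contradicts `x`
  -- being in the support.
  have h0 : orbitMean m p (f.comp ⟨fun y => s • y, continuous_const_smul s⟩) ≤ orbitMean m p 0 :=
    orbitMean_mono hm.1 p _ _ fun t => (hf0 ⟨t • p, hF.prop.2.2 t p hp, rfl⟩).le
  rw [orbitMean_comp_smul hm, map_zero] at h0
  exact h0.not_gt h

end Mean

/-- A totally bounded set with at least two points has a point in its convex hull which is
uniformly closer to all points of the set than its diameter. -/
theorem exists_mem_convexHull_dist_le_lt_diam {V : Type*} [NormedAddCommGroup V] [NormedSpace ℝ V]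
    {G : Set V} (hG : TotallyBounded G) (hnt : G.Nontrivial) :
    ∃ u ∈ convexHull ℝ G, ∃ r < Metric.diam G, ∀ y ∈ G, dist u y ≤ r := by
  classical
  have hb := hG.isBounded
  have hd : 0 < Metric.diam G := by
    obtain ⟨a, ha, b, hb', hab⟩ := hnt
    exact (dist_pos.2 hab).trans_le (Metric.dist_le_diam_of_mem hb ha hb')
  set d := Metric.diam G with hd_def
  obtain ⟨t, htG, htf, hcov⟩ := Metric.finite_approx_of_totallyBounded hG (d / 2) (half_pos hd)
  lift t to Finset V using htf
  obtain ⟨y₀, hy₀⟩ := hnt.nonempty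
  have htne : t.Nonempty := by
    obtain ⟨x, hx, -⟩ := mem_iUnion₂.1 (hcov hy₀)
    exact ⟨x, hx⟩
  have hn : (0 : ℝ) < t.card := by exact_mod_cast htne.card_pos
  -- The centroid of a d/2-net: for each `y` one net point is within d/2 and the others within d, so
  -- the average distance is at most d - d/(2n), where n is the size of the net.
  refine ⟨t.centerMass (fun _ => (1 : ℝ)) id, ?_, (t.card * d - d / 2) / t.card, ?_, ?_⟩
  · exact Finset.centerMass_mem_convexHull t (fun _ _ => zero_le_one) (by simpa using hn)
      fun x hx => htG hx
  · rw [div_lt_iff₀ hn]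
    linarith
  · intro y hy
    obtain ⟨x₀, hx₀, hyx⟩ := mem_iUnion₂.1 (hcov hy)
    have hu : t.centerMass (fun _ => (1 : ℝ)) id - y
        = (t.card : ℝ)⁻¹ • ∑ x ∈ t, (x - y) := by
      simp only [Finset.centerMass, Finset.sum_const, nsmul_eq_mul, mul_one, one_smul, id,
        Finset.sum_sub_distrib, smul_sub]
      rw [← Nat.cast_smul_eq_nsmul ℝ, smul_smul, inv_mul_cancel₀ hn.ne', one_smul]
    have hsum : ∑ x ∈ t, ‖x - y‖ ≤ t.card * d - d / 2 := by
      rw [← Finset.add_sum_erase t _ hx₀]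
      have h1 : ‖x₀ - y‖ ≤ d / 2 := by
        rw [← dist_eq_norm, dist_comm]
        exact (Metric.mem_ball.1 hyx).le
      have h2 : ∑ x ∈ t.erase x₀, ‖x - y‖ ≤ (t.erase x₀).card • d :=
        Finset.sum_le_card_nsmul _ _ _ fun x hx => by
          rw [← dist_eq_norm]
          exact Metric.dist_le_diam_of_mem hb (htG (Finset.mem_of_mem_erase hx)) hy
      rw [Finset.card_erase_of_mem hx₀, nsmul_eq_mul, Nat.cast_pred htne.card_pos] at h2
      linarith
    rw [dist_eq_norm, hu, norm_smul, norm_inv, Real.norm_natCast, inv_mul_eq_div]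
    exact div_le_div_of_nonneg_right ((norm_sum_le _ _).trans hsum) hn.le

/-! ### From norm separability to norm total boundedness. -/

section Fragmentability

variable {X M : Type*} [TopologicalSpace X] [PseudoMetricSpace M] {j : X → M}

/-- If `j : X → M` has separable range and is such that the distance of `M` is lower semicontinuous
on `X`, then every nonempty compact subset of `X` has a nonempty relatively open subset that `j`
maps into a given small ball around a point of the subset. -/
theorem exists_isOpen_image_subset_closedBall [T2Space X]
    (hj : ∀ z r, IsClosed {x | dist (j x) (j z) ≤ r}) {F : Set X} (hF : IsCompact F)
    (hne : F.Nonempty) (hsep : TopologicalSpace.IsSeparable (j '' F)) {ε : ℝ} (hε : 0 < ε) :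
    ∃ z ∈ F, ∃ V : Set X, IsOpen V ∧ (V ∩ F).Nonempty ∧ ∀ x ∈ V ∩ F, dist (j x) (j z) ≤ ε := by
  obtain ⟨c, hcF, hc, hdense⟩ := hsep.exists_countable_dense_subset
  have : CompactSpace F := isCompact_iff_compactSpace.1 hF
  have : Nonempty F := hne.to_subtype
  have : Countable c := hc.to_subtype
  have : Nonempty X := ⟨hne.some⟩
  choose! g hgF hg using fun i (hi : i ∈ c) => hcF hi
  -- Baire: countably many balls, closed in the topology of `X`, cover `F`.
  obtain ⟨i, x, hx⟩ := nonempty_interior_of_iUnion_of_closed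
    (f := fun i : c => {x : F | dist (j x) (j (g i)) ≤ ε})
    (fun i => (hj _ _).preimage continuous_subtype_val) (by
      refine eq_univ_of_forall fun x => ?_
      obtain ⟨i, hi, hxi⟩ := Metric.mem_closure_iff.1 (hdense (mem_image_of_mem j x.2)) ε hε
      refine mem_iUnion.2 ⟨⟨i, hi⟩, ?_⟩
      change dist (j x) (j (g i)) ≤ ε
      rw [hg i hi]
      exact hxi.le)
  obtain ⟨W, hW, hWo, hxW⟩ := mem_interior.1 hx
  obtain ⟨V, hV, rfl⟩ := isOpen_induced_iff.1 hWo
  exact ⟨g i, hgF i i.2, V, hV, ⟨x, hxW, x.2⟩, fun y hy => hW (a := ⟨y, hy.2⟩) hy.1⟩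

variable {S : Type*} [Semigroup S] [TopologicalSpace S] [SeparatelyContinuousMul S]
  [SemigroupAction S X]

/-- Every point `x` has a closed left ideal whose elements do not increase the distance from `x`. -/
def IsNonexpansiveAlongIdeals (S : Type*) [Semigroup S] [TopologicalSpace S]
    [SemigroupAction S X] (j : X → M) : Prop :=
  ∀ x : X, ∃ I : Set S, IsLeftIdeal I ∧ IsClosed I ∧
    ∀ s ∈ I, ∀ y : X, dist (j (s • x)) (j (s • y)) ≤ dist (j x) (j y)

theorem IsMinimalInvariant.totallyBounded_image [T2Space X] [CompactSpace X] [ContinuousSMul S X]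
    (hrev : IsRightReversible S) (hamen : IsLeftAmenable S)
    (hj : ∀ r, IsClosed {p : X × X | dist (j p.1) (j p.2) ≤ r})
    (hact : IsNonexpansiveAlongIdeals S j) {F : Set X} (hF : IsMinimalInvariant S F)
    (hsep : TopologicalSpace.IsSeparable (j '' F)) : TotallyBounded (j '' F) := by
  have hS : Nonempty S := hamen.elim fun m hm => hm.1.nonempty
  refine Metric.totallyBounded_of_finite_discretization fun ε hε => ?_
  obtain ⟨z, hzF, V, hV, hVne, hVz⟩ := exists_isOpen_image_subset_closedBall (j := j)
    (fun z r => (hj r).preimage (continuous_id.prodMk continuous_const)) hF.prop.1 hF.prop.2.1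
    hsep (ε := ε / 4) (by positivity)
  obtain ⟨I, hI, hIc, hIz⟩ := hact z
  obtain ⟨t, ht⟩ := hF.prop.1.elim_finite_subcover (fun s : S => {x | s • x ∈ V})
    (fun s => hV.preimage (continuous_const_smul s))
    (fun x hx => mem_iUnion.2 (hF.exists_smul_mem hV hVne hx))
  -- A single `s` is a limit of elements b * a with b in `I`, for every `a` of the finite cover at
  -- once.
  obtain ⟨s, hs⟩ := hrev.biInter_nonempty t (fun a => closure ((fun b => b * a) '' I))
    (fun a => (hI.image_mul_right a).closure) (fun a => isClosed_closure)
  have hsmall : ∀ a ∈ t, ∀ x ∈ F, ∀ y ∈ F, a • x ∈ V → a • y ∈ V →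
      dist (j (s • x)) (j (s • y)) ≤ ε / 2 := by
    intro a ha x hx y hy hax hay
    have hcl : IsClosed {b : S | dist (j (b • x)) (j (b • y)) ≤ ε / 2} :=
      (hj (ε / 2)).preimage ((continuous_id.smul continuous_const).prodMk
        (continuous_id.smul continuous_const))
    refine closure_minimal ?_ hcl (mem_iInter₂.1 hs a ha)
    rintro _ ⟨b, hb, rfl⟩
    have key : ∀ w ∈ F, a • w ∈ V → dist (j ((b * a) • w)) (j (b • z)) ≤ ε / 4 := by
      intro w hw haw
      rw [mul_smul, dist_comm]
      refine (hIz b hb (a • w)).trans ?_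
      rw [dist_comm]
      exact hVz _ ⟨haw, hF.prop.2.2 a w hw⟩
    change dist (j ((b * a) • x)) (j ((b * a) • y)) ≤ ε / 2
    refine (dist_triangle_right _ _ (j (b • z))).trans ?_
    linarith [key x hx hax, key y hy hay]
  -- Since sF = F, the small images under `s` of the cover exhaust `F`.
  have hex : ∀ q : ↥(j '' F), ∃ a : t, ∃ x ∈ F, a.1 • x ∈ V ∧ j (s • x) = q := by
    rintro ⟨_, x, hx, rfl⟩
    obtain ⟨y, hy, rfl⟩ := hF.exists_smul_eq hamen s hx
    obtain ⟨a, ha, hay⟩ := mem_iUnion₂.1 (ht hy)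
    exact ⟨⟨a, ha⟩, y, hy, hay, rfl⟩
  choose φ x hxF hxV hxq using hex
  refine ⟨ULift (Fin t.card), inferInstance, fun q => ⟨t.equivFin (φ q)⟩, fun p q hpq => ?_⟩
  have hφ : φ p = φ q := t.equivFin.injective (ULift.up.inj hpq)
  rw [← hxq p, ← hxq q]
  have := hsmall (φ p) (φ p).2 (x p) (hxF p) (x q) (hxF q) (hxV p) (hφ ▸ hxV q)
  linarith

end Fragmentability

/-! ### Weak* lower semicontinuity of the dual norm. -/

section Dual

variable {𝕜 : Type*} [RCLike 𝕜] {E : Type*} [NormedAddCommGroup E] [NormedSpace 𝕜 E]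

theorem isClosed_setOf_dist_toStrongDual_le (r : ℝ) :
    IsClosed {p : WeakDual 𝕜 E × WeakDual 𝕜 E |
      dist (WeakDual.toStrongDual p.1) (WeakDual.toStrongDual p.2) ≤ r} := by
  convert! (WeakDual.isClosed_closedBall (0 : StrongDual 𝕜 E) r).preimage
    (continuous_fst.sub continuous_snd :
      Continuous fun p : WeakDual 𝕜 E × WeakDual 𝕜 E => p.1 - p.2) using 1
  ext p
  simp [dist_eq_norm]

variable {S : Type*} [Semigroup S] [TopologicalSpace S] [SeparatelyContinuousMul S]
  {K : Set (WeakDual 𝕜 E)} [SemigroupAction S K]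

theorem IsSuperAsymptoticallyNonexpansive.isNonexpansiveAlongIdeals [Nonempty S]
    [ContinuousSMul S K] (hact : IsSuperAsymptoticallyNonexpansive S K) :
    IsNonexpansiveAlongIdeals S (fun x : K => WeakDual.toStrongDual x.1) := by
  intro x
  obtain ⟨I, hI, -, hIx⟩ := hact x (Classical.arbitrary S)
  refine ⟨closure I, hI.closure, isClosed_closure, fun s hs y => ?_⟩
  have hcl : IsClosed {s : S | dist (WeakDual.toStrongDual (s • x : K).1)
      (WeakDual.toStrongDual (s • y : K).1)
        ≤ dist (WeakDual.toStrongDual x.1) (WeakDual.toStrongDual y.1)} :=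
    (isClosed_setOf_dist_toStrongDual_le _).preimage
      ((continuous_subtype_val.comp (continuous_id.smul continuous_const)).prodMk
        (continuous_subtype_val.comp (continuous_id.smul continuous_const)))
  refine closure_minimal (fun b hb => ?_) hcl hs
  simpa only [dist_eq_norm, mem_ofPred_eq] using hIx b hb y

end Dual

end SemitopologicalSemigroup

open SemitopologicalSemigroup in
theorem mainTheorem2
    {S : Type*} [Semigroup S] [TopologicalSpace S] [T2Space S] [SeparatelyContinuousMul S]
    (hrev : SemitopologicalSemigroup.IsRightReversible S)
    (hamen : SemitopologicalSemigroup.IsLeftAmenable S)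
    {𝕜 : Type*} [RCLike 𝕜]
    {E : Type*} [NormedAddCommGroup E] [NormedSpace 𝕜 E] [CompleteSpace E]
    (K : Set (WeakDual 𝕜 E)) (hne : K.Nonempty) (hcomp : IsCompact K) (hconv : Convex ℝ K)
    (hsep : TopologicalSpace.IsSeparable (WeakDual.toStrongDual '' K))
    [SemigroupAction S K] [ContinuousSMul S K]
    (hact : SemitopologicalSemigroup.IsSuperAsymptoticallyNonexpansive S K) :
    ∃ x : K, ∀ s : S, s • x = x := by
  have hS : Nonempty S := hamen.elim fun m hm => hm.1.nonempty
  have : CompactSpace K := isCompact_iff_compactSpace.1 hcomp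
  have hnonexp := hact.isNonexpansiveAlongIdeals
  set j : K → StrongDual 𝕜 E := fun x => WeakDual.toStrongDual x.1 with hj_def
  have hj : ∀ r, IsClosed {p : K × K | dist (j p.1) (j p.2) ≤ r} := fun r =>
    (isClosed_setOf_dist_toStrongDual_le r).preimage
      (continuous_subtype_val.prodMap continuous_subtype_val)
  -- Stability under limit sets is asked instead of invariance, since elements outside the ideals
  -- may increase distances.
  obtain ⟨C, hCK, hC⟩ := exists_minimal_isCompact
    (P := fun C : Set (WeakDual 𝕜 E) => Convex ℝ C ∧
      ∀ x : K, x.1 ∈ C → ∀ y ∈ limitSet S x, y.1 ∈ C)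
    (fun c hc _ => ⟨convex_sInter fun A hA => (hc A hA).1, fun x hx y hy => mem_sInter.2
      fun A hA => (hc A hA).2 x (mem_sInter.1 hx A hA) y hy⟩)
    hcomp hne ⟨hconv, fun _ _ y _ => y.2⟩
  obtain ⟨x₀, hx₀⟩ := hC.prop.2.1
  obtain ⟨F, hFl, hF⟩ := exists_isMinimalInvariant
    (isClosed_limitSet (S := S) (⟨x₀, hCK hx₀⟩ : K)).isCompact (limitSet_nonempty hrev _)
    (isInvariant_limitSet _)
  have hFC : ∀ y ∈ F, y.1 ∈ C := fun y hy => hC.prop.2.2.2 _ hx₀ y (hFl hy)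
  have htb : TotallyBounded (j '' F) := hF.totallyBounded_image hrev hamen hj hnonexp
    (hsep.mono (by rintro _ ⟨y, -, rfl⟩; exact ⟨y.1, y.2, rfl⟩))
  rcases (j '' F).subsingleton_or_nontrivial with hsub | hnt
  · obtain ⟨p, hp⟩ := hF.prop.2.1
    refine ⟨p, fun s => Subtype.ext (WeakDual.toStrongDual.injective ?_)⟩
    exact hsub (mem_image_of_mem j (hF.prop.2.2 s p hp)) (mem_image_of_mem j hp)
  · exfalso
    obtain ⟨u, hu, r, hr, hur⟩ := exists_mem_convexHull_dist_le_lt_diam htb hnt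
    let B : Set (WeakDual 𝕜 E) :=
      ⋂ y ∈ F, WeakDual.toStrongDual ⁻¹' Metric.closedBall (j y) r
    have hB : IsClosed B := isClosed_biInter fun y _ => WeakDual.isClosed_closedBall _ r
    have hBconv : Convex ℝ B := convex_iInter₂ fun y _ a ha b hb α β hα hβ hαβ =>
      convex_closedBall (j y) r ha hb hα hβ hαβ
    have huC : u ∈ WeakDual.toStrongDual '' C := by
      refine convexHull_min ?_ ?_ hu
      · rintro _ ⟨y, hy, rfl⟩
        exact ⟨y.1, hFC y hy, rfl⟩
      · rintro _ ⟨a, ha, rfl⟩ _ ⟨b, hb, rfl⟩ α β hα hβ hαβ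
        exact ⟨α • a + β • b, hC.prop.2.2.1 ha hb hα hβ hαβ, rfl⟩
    obtain ⟨u, huC, rfl⟩ := huC
    have hBC : C ∩ B = C := by
      refine Minimal.eq_of_subset hC ⟨hC.prop.1.inter_right hB,
        ⟨u, huC, mem_iInter₂.2 fun y hy => hur _ (mem_image_of_mem j hy)⟩,
        hC.prop.2.2.1.inter hBconv, fun x hx y hy => ⟨hC.prop.2.2.2 x hx.1 y hy, ?_⟩⟩
        inter_subset_left
      obtain ⟨I, hI, hIc, hIx⟩ := hnonexp x
      refine closure_minimal ?_ (hB.preimage continuous_subtype_val) (limitSet_subset hI hIc x hy)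
      rintro _ ⟨s, hs, rfl⟩
      refine mem_iInter₂.2 fun w hw => ?_
      -- Writing w = s • v turns the bound on the distance from `x` to `v` into one from s • x to
      -- `w`.
      obtain ⟨v, hv, rfl⟩ := hF.exists_smul_eq hamen s hw
      exact (hIx s hs v).trans (mem_iInter₂.1 hx.2 v hv)
    have hr0 : 0 ≤ r := by
      obtain ⟨y, hy⟩ := hF.prop.2.1
      exact dist_nonneg.trans (hur _ (mem_image_of_mem j hy))
    refine hr.not_ge (Metric.diam_le_of_forall_dist_le hr0 ?_)
    rintro _ ⟨x, hx, rfl⟩ _ ⟨y, hy, rfl⟩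
    have hxB : x.1 ∈ C ∩ B := hBC.symm ▸ hFC x hx
    exact mem_iInter₂.1 hxB.2 y hy
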